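/- Let $G$ be a graph (without loops or multiple edges) that contains a cycle, and let $S(G)$ be the free unital semigroup with relations in $G$, that is, the set of finite words over the vertices of $G$ under concatenation, with the empty word $e$ as neutral element, modulo the relations $uv=vu$ for all edges $\{u,v\}$ of $G$. Then there are a complex Hilbert space $H$ and a semigroup of contractions $(T_s)_{s\in S(G)}$ on $H$ (so $T_e=I_H$, $T_{st}=T_sT_t$ and $\|T_s\|\le 1$ for all $s,t\in S(G)$) that has no co-extension to a semigroup of isometries: there do not exist a Hilbert space $K\supseteq H$ and a semigroup of isometries $(V_s)_{s\in S(G)}$ on $K$ (so $V_e=I_K$ and $V_{st}=V_sV_t$ for all $s,t\in S(G)$) such that $V_s$ is a co-extension of $T_s$ for every $s\in S(G)$, i.e. such that $V_s^*h=T_s^*h$ for all $h\in H$ and $s\in S(G)$. -/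

import Mathlib

/-- The one-step commutation relations encoded by a graph `G` on words over its vertices:
`u v` is related to `v u` whenever `{u, v}` is an edge of `G`. -/
def commRel {V : Type*} (G : SimpleGraph V) (x y : FreeMonoid V) : Prop :=
  ∃ u v : V, G.Adj u v ∧ x = FreeMonoid.of u * FreeMonoid.of v ∧
    y = FreeMonoid.of v * FreeMonoid.of u

/-- The free unital semigroup with relations in `G`: words over the vertices of `G`, modulo
rewriting `r₀ u v r₁` into `r₀ v u r₁` for edges `{u, v}` of `G`. -/
abbrev GraphSemigroup {V : Type*} (G : SimpleGraph V) : Type _ :=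
  PresentedMonoid (commRel G)

/-- `W`, acting on a Hilbert space `K` that contains `H` through the linear isometric embedding
`J`, is a co-extension of the operator `T` on `H`: the adjoint of `W` extends the adjoint of `T`,
that is, it leaves `H` invariant and restricts there to the adjoint of `T`. -/
def IsCoextension {H K : Type*}
    [NormedAddCommGroup H] [InnerProductSpace ℂ H] [CompleteSpace H]
    [NormedAddCommGroup K] [InnerProductSpace ℂ K] [CompleteSpace K]
    (J : H →ₗᵢ[ℂ] K) (W : K →L[ℂ] K) (T : H →L[ℂ] H) : Prop :=
  ∀ h : H, ContinuousLinearMap.adjoint W (J h) = J (ContinuousLinearMap.adjoint T h)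

/-!
The contractions are of Parrott type. Fix a Hilbert space `E`, let `H = E ⊕ E`, and attach to a
vertex `v` the contraction `T_v (x, y) = (0, A_v x)`, where `A_v` is a unitary operator on `E`. Any
product of two such operators vanishes, so they all commute, whatever the graph is.

Suppose that `W_v` is an isometric co-extension of `T_v` for every `v`. As `T_v` preserves the norm
of `(x, 0)`, the operator `W_v` is forced to agree with `T_v` there: `W_v (x, 0) = (0, A_v x)`
(`IsCoextension.apply_eq_of_norm_eq`). Applying `W_u W_v = W_v W_u` to `(x, 0)` for an edge
`{u, v}` gives `W_u (0, A_v x) = W_v (0, A_u x)`. If `A_u` and `A_v` commute, this says that the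
maps `x ↦ W_v (0, A_v⁻¹ x)` and `x ↦ W_u (0, A_u⁻¹ x)` coincide.

As `G` contains a cycle, it has an edge `{a, b}` whose removal leaves `a` and `b` connected. Let
`A_v = 1` except at `a` and `b`, where two noncommuting unitaries are placed. Then `{a, b}` is the
only edge whose two unitaries do not commute, so the map `x ↦ W_v (0, A_v⁻¹ x)` is constant along
a walk from `a` to `b` that avoids this edge. Combined with the relation of the edge `{a, b}`
itself and the injectivity of `W_a`, this makes `A_a` and `A_b` commute, a contradiction
(`parrottHom_not_exists_isometric_coextension`).
-/

/-! ### Cycles in graphs -/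

theorem SimpleGraph.Reachable.apply_eq_of_forall_adj {V α : Type*} {G : SimpleGraph V} {f : V → α}
    {a b : V} (h : G.Reachable a b) (hf : ∀ u v, G.Adj u v → f u = f v) : f a = f b := by
  obtain ⟨p⟩ := h
  induction p with
  | nil => rfl
  | cons h _ ih => exact (hf _ _ h).trans ih

theorem SimpleGraph.exists_adj_reachable_deleteEdges_of_isCycle {V : Type*} {G : SimpleGraph V}
    (hG : ∃ (v : V) (c : G.Walk v v), c.IsCycle) :
    ∃ a b, G.Adj a b ∧ (G.deleteEdges {s(a, b)}).Reachable a b := by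
  obtain ⟨v, c, hc⟩ := hG
  by_contra! h
  exact SimpleGraph.isAcyclic_iff_forall_adj_isBridge.2
    (fun a b hab => SimpleGraph.isBridge_iff.2 (h a b hab)) c hc

/-! ### Isometric co-extensions -/

section

variable {H K : Type*}
  [NormedAddCommGroup H] [InnerProductSpace ℂ H] [CompleteSpace H]
  [NormedAddCommGroup K] [InnerProductSpace ℂ K] [CompleteSpace K]

/-- An isometric co-extension of `T` is an extension of `T` at every vector whose norm `T`
preserves: the compression of `W` to `H` is `T`, so `W` has no room for a further component. -/
theorem IsCoextension.apply_eq_of_norm_eq {J : H →ₗᵢ[ℂ] K} {W : K →L[ℂ] K} {T : H →L[ℂ] H}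
    (hWT : IsCoextension J W T) (hW : Isometry W) {h : H} (hT : ‖T h‖ = ‖h‖) :
    W (J h) = J (T h) := by
  have hnorm : ‖W (J h)‖ = ‖h‖ := by
    rw [(AddMonoidHomClass.isometry_iff_norm W).1 hW, J.norm_map]
  have hinner : inner ℂ (W (J h)) (J (T h)) = inner ℂ (T h) (T h) := by
    rw [← ContinuousLinearMap.adjoint_inner_right, hWT, J.inner_map_map,
      ContinuousLinearMap.adjoint_inner_right]
  rw [← sub_eq_zero, ← norm_eq_zero, ← sq_eq_zero_iff, @norm_sub_sq ℂ, hinner, hnorm, J.norm_map,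
    inner_self_eq_norm_sq, hT]
  ring

end

/-! ### Representations of graph semigroups -/

section

variable {V : Type*} {G : SimpleGraph V}

theorem GraphSemigroup.of_mul_of_comm {u v : V} (h : G.Adj u v) :
    PresentedMonoid.of (commRel G) u * PresentedMonoid.of (commRel G) v =
      PresentedMonoid.of (commRel G) v * PresentedMonoid.of (commRel G) u :=
  PresentedMonoid.mk_eq_mk_of_rel ⟨u, v, h, rfl, rfl⟩

/-- The representation of the graph semigroup with prescribed values on the vertices. -/
def GraphSemigroup.lift {M : Type*} [Monoid M] (f : V → M)
    (hf : ∀ u v, G.Adj u v → Commute (f u) (f v)) : GraphSemigroup G →* M :=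
  PresentedMonoid.lift f (by
    rintro _ _ ⟨u, v, huv, rfl, rfl⟩
    simpa using (hf u v huv).eq)

theorem GraphSemigroup.lift_of {M : Type*} [Monoid M] (f : V → M)
    (hf : ∀ u v, G.Adj u v → Commute (f u) (f v)) (v : V) :
    GraphSemigroup.lift f hf (PresentedMonoid.of (commRel G) v) = f v :=
  PresentedMonoid.lift_of f _

theorem GraphSemigroup.norm_map_le_one {H : Type*} [NormedAddCommGroup H] [InnerProductSpace ℂ H]
    (T : GraphSemigroup G →* (H →L[ℂ] H))
    (hT : ∀ v, ‖T (PresentedMonoid.of (commRel G) v)‖ ≤ 1) (s : GraphSemigroup G) :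
    ‖T s‖ ≤ 1 := by
  induction s using PresentedMonoid.inductionOn with | _ a
  induction a with
  | one => rw [map_one, map_one]; exact ContinuousLinearMap.norm_id_le
  | of v => exact hT v
  | mul a b ha hb =>
    rw [map_mul, map_mul]
    exact (norm_mul_le _ _).trans (mul_le_one₀ ha (norm_nonneg _) hb)

end

/-! ### Parrott operators -/

section

variable {E : Type*} [NormedAddCommGroup E] [InnerProductSpace ℂ E]

/-- The operator `(x, y) ↦ (0, A x)` on the Hilbert sum `E ⊕ E`. -/
noncomputable def parrottOp (A : E ≃ₗᵢ[ℂ] E) : WithLp 2 (E × E) →L[ℂ] WithLp 2 (E × E) :=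
  LinearMap.mkContinuous
    { toFun := fun z => WithLp.toLp 2 (0, A z.fst)
      map_add' := fun z w => by rw [WithLp.add_fst, map_add, ← WithLp.toLp_add]; simp
      map_smul' := fun c z => by rw [WithLp.smul_fst, map_smul, ← WithLp.toLp_smul]; simp }
    1 fun z => by
      simpa using WithLp.norm_fst_le E z

theorem parrottOp_apply (A : E ≃ₗᵢ[ℂ] E) (z : WithLp 2 (E × E)) :
    parrottOp A z = WithLp.toLp 2 (0, A z.fst) :=
  rfl

theorem norm_parrottOp_le_one (A : E ≃ₗᵢ[ℂ] E) : ‖parrottOp A‖ ≤ 1 :=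
  LinearMap.mkContinuous_norm_le _ zero_le_one _

theorem parrottOp_mul_parrottOp (A B : E ≃ₗᵢ[ℂ] E) : parrottOp A * parrottOp B = 0 := by
  ext1 z
  simp [parrottOp_apply]

variable {V : Type*} {G : SimpleGraph V}

/-- The representation of the graph semigroup that sends a vertex `v` to the Parrott operator
of `A v`. -/
noncomputable def parrottHom (G : SimpleGraph V) (A : V → E ≃ₗᵢ[ℂ] E) :
    GraphSemigroup G →* (WithLp 2 (E × E) →L[ℂ] WithLp 2 (E × E)) :=
  GraphSemigroup.lift (fun v => parrottOp (A v)) fun u v _ => by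
    rw [commute_iff_eq, parrottOp_mul_parrottOp, parrottOp_mul_parrottOp]

theorem parrottHom_of (A : V → E ≃ₗᵢ[ℂ] E) (v : V) :
    parrottHom G A (PresentedMonoid.of (commRel G) v) = parrottOp (A v) :=
  GraphSemigroup.lift_of _ _ v

variable [CompleteSpace E]

/-- If the unitaries `A u` and `A v` commute along all edges except one edge `{a, b}` that is not a
bridge, then the Parrott operators admit no isometric co-extension: the holonomy around a cycle
through `{a, b}` would have to be trivial. -/
theorem parrottHom_not_exists_isometric_coextension (A : V → E ≃ₗᵢ[ℂ] E) {a b : V}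
    (hab : G.Adj a b) (hr : (G.deleteEdges {s(a, b)}).Reachable a b)
    (hcomm : ∀ u v, (G.deleteEdges {s(a, b)}).Adj u v → Commute (A u) (A v))
    (hA : ¬ Commute (A a) (A b))
    {K : Type*} [NormedAddCommGroup K] [InnerProductSpace ℂ K] [CompleteSpace K]
    (J : WithLp 2 (E × E) →ₗᵢ[ℂ] K) :
    ¬ ∃ W : GraphSemigroup G →* (K →L[ℂ] K),
      (∀ s, Isometry (W s)) ∧ ∀ s, IsCoextension J (W s) (parrottHom G A s) := by
  rintro ⟨W, hW, hWT⟩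
  let w (v : V) : K →L[ℂ] K := W (PresentedMonoid.of (commRel G) v)
  have hw (v : V) (x : E) :
      w v (J (WithLp.toLp 2 (x, 0))) = J (WithLp.toLp 2 (0, A v x)) := by
    have hco := hWT (PresentedMonoid.of (commRel G) v)
    rw [parrottHom_of] at hco
    refine hco.apply_eq_of_norm_eq (hW _) ?_
    simp [parrottOp_apply]
  have hedge (u v : V) (huv : G.Adj u v) (x : E) :
      w u (J (WithLp.toLp 2 (0, A v x))) = w v (J (WithLp.toLp 2 (0, A u x))) := by
    have h : w u * w v = w v * w u := by
      simp only [w, ← map_mul, GraphSemigroup.of_mul_of_comm huv]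
    rw [← hw, ← hw]
    exact DFunLike.congr_fun h _
  -- The map that does not change along an edge whose unitaries commute.
  let D (v : V) (x : E) : K := w v (J (WithLp.toLp 2 (0, (A v)⁻¹ x)))
  have hD (u v : V) (huv : (G.deleteEdges {s(a, b)}).Adj u v) : D u = D v := by
    funext x
    have hc := hcomm u v huv
    have hu : A v (((A u)⁻¹ * (A v)⁻¹) x) = (A u)⁻¹ x := by
      have h : A v * ((A u)⁻¹ * (A v)⁻¹) = (A u)⁻¹ := by
        rw [← mul_assoc, hc.symm.inv_right.eq, mul_inv_cancel_right]
      exact DFunLike.congr_fun h x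
    have hv : A u (((A u)⁻¹ * (A v)⁻¹) x) = (A v)⁻¹ x :=
      DFunLike.congr_fun (mul_inv_cancel_left (A u) (A v)⁻¹) x
    have h := hedge u v ((G.deleteEdges_le _) huv) (((A u)⁻¹ * (A v)⁻¹) x)
    rwa [hu, hv] at h
  have hDab : D a = D b := hr.apply_eq_of_forall_adj hD
  refine hA (LinearIsometryEquiv.ext fun x => ?_)
  -- The maps agree at `A b (A a x)`; the relation of the edge `{a, b}` evaluates the right side.
  have h : w a (J (WithLp.toLp 2 (0, (A a)⁻¹ (A b (A a x))))) =
      w a (J (WithLp.toLp 2 (0, A b x))) := by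
    rw [hedge a b hab]
    have h := congr_fun hDab (A b (A a x))
    have hb : (A b)⁻¹ (A b (A a x)) = A a x :=
      DFunLike.congr_fun (inv_mul_cancel (A b)) (A a x)
    simpa only [D, hb] using h
  have h' : (A a)⁻¹ (A b (A a x)) = A b x :=
    congr_arg WithLp.snd (J.injective ((hW _).injective h))
  change A a (A b x) = A b (A a x)
  rw [← h']
  exact DFunLike.congr_fun (mul_inv_cancel (A a)) (A b (A a x))

end

/-! ### Noncommuting unitaries -/

/-- The swap and the reflection `diag(1, -1)` of `ℂ²`. -/
theorem exists_not_commute_linearIsometryEquiv :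
    ∃ P Q : WithLp 2 (ℂ × ℂ) ≃ₗᵢ[ℂ] WithLp 2 (ℂ × ℂ), ¬ Commute P Q := by
  refine ⟨LinearIsometryEquiv.withLpProdComm 2 ℂ ℂ ℂ,
    LinearIsometryEquiv.withLpProdCongr 2 (.refl ℂ ℂ) (.neg ℂ), fun h => ?_⟩
  have h1 := congr_arg WithLp.snd (DFunLike.congr_fun h.eq (WithLp.toLp 2 (1, 0)))
  change (1 : ℂ) = -1 at h1
  norm_num at h1

/-! ### Graphs with a cycle -/

theorem mainTheorem6 {V : Type*} (G : SimpleGraph V)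
    (hG : ∃ (v : V) (c : G.Walk v v), c.IsCycle) :
    ∃ (H : Type) (_ : NormedAddCommGroup H) (_ : InnerProductSpace ℂ H) (_ : CompleteSpace H)
      (T : GraphSemigroup G →* (H →L[ℂ] H)),
      (∀ s, ‖T s‖ ≤ 1) ∧
      ∀ (K : Type*) [NormedAddCommGroup K] [InnerProductSpace ℂ K] [CompleteSpace K]
        (J : H →ₗᵢ[ℂ] K),
        ¬ ∃ W : GraphSemigroup G →* (K →L[ℂ] K),
          (∀ s, Isometry (W s)) ∧ ∀ s, IsCoextension J (W s) (T s) := by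
  classical
  obtain ⟨a, b, hab, hr⟩ := SimpleGraph.exists_adj_reachable_deleteEdges_of_isCycle hG
  obtain ⟨P, Q, hPQ⟩ := exists_not_commute_linearIsometryEquiv
  let A : V → WithLp 2 (ℂ × ℂ) ≃ₗᵢ[ℂ] WithLp 2 (ℂ × ℂ) :=
    fun v => if v = a then P else if v = b then Q else 1
  have hAa : A a = P := if_pos rfl
  have hAb : A b = Q := (if_neg hab.ne').trans (if_pos rfl)
  have hcomm (u v : V) (huv : (G.deleteEdges {s(a, b)}).Adj u v) : Commute (A u) (A v) := by
    rw [SimpleGraph.deleteEdges_adj, Set.mem_singleton_iff, Sym2.eq_iff] at huv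
    have hne := huv.1.ne
    simp only [A]
    split_ifs <;> first | exact Commute.one_left _ | exact Commute.one_right _ | grind
  refine ⟨WithLp 2 (WithLp 2 (ℂ × ℂ) × WithLp 2 (ℂ × ℂ)), inferInstance, inferInstance,
    inferInstance, parrottHom G A, GraphSemigroup.norm_map_le_one _ fun v => ?_, ?_⟩
  · rw [parrottHom_of]
    exact norm_parrottOp_le_one _
  · intro K _ _ _ J
    exact parrottHom_not_exists_isometric_coextension A hab hr hcomm (by rwa [hAa, hAb]) J
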